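/- A \emph{$B$-term} is a term built from the constant $B$ alone by (left-associative) binary application. Each $B$-term is read as a closed untyped $\lambda$-term by replacing $B$ with $\lambda x.\lambda y.\lambda z.\,x\,(y\,z)$. Theorem. Let $e_1$ and $e_2$ be $B$-terms. The $\lambda$-terms of $e_1$ and $e_2$ are $\beta\eta$-equivalent if and only if the equality $e_1 = e_2$ can be derived in equational logic (that is, by reflexivity, symmetry, transitivity and replacement of equals by equals under application) from the equations \begin{align} B\,x\,y\,z &= x\,(y\,z), \tag{B1}\\ B\,(B\,x\,y) &= B\,(B\,x)\,(B\,y), \tag{B2}\\ B\,B\,(B\,x) &= B\,(B\,(B\,x))\,B, \tag{B3} \end{align} where $x$, $y$, $z$ may be instantiated by arbitrary $B$-terms. -/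

import Mathlib

/-- Untyped λ-terms modulo α-conversion, in de Bruijn notation: `var n` is bound by the
`n`-th enclosing `lam` (counting from `0`, innermost first), and is free if there is none. -/
inductive Lam : Type where
  | var : ℕ → Lam
  | app : Lam → Lam → Lam
  | lam : Lam → Lam

namespace Lam

/-- The extension of a renaming of variables under one binder. -/
def liftRen (ξ : ℕ → ℕ) : ℕ → ℕ
  | 0 => 0
  | n + 1 => ξ n + 1

/-- Renaming of the free variables of a term. -/
def rename : (ℕ → ℕ) → Lam → Lam
  | ξ, var n => var (ξ n)
  | ξ, app s t => app (rename ξ s) (rename ξ t)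
  | ξ, lam s => lam (rename (liftRen ξ) s)

/-- Weakening: all free variables are moved past one new binder. -/
def shift (t : Lam) : Lam := rename Nat.succ t

/-- The extension of a substitution under one binder. -/
def liftSub (σ : ℕ → Lam) : ℕ → Lam
  | 0 => var 0
  | n + 1 => shift (σ n)

/-- Simultaneous capture-avoiding substitution for the free variables of a term. -/
def subst : (ℕ → Lam) → Lam → Lam
  | σ, var n => σ n
  | σ, app s t => app (subst σ s) (subst σ t)
  | σ, lam s => lam (subst (liftSub σ) s)

/-- The substitution that replaces variable `0` by `t` and removes its binder. -/
def single (t : Lam) : ℕ → Lam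
  | 0 => t
  | n + 1 => var n

/-- One-step βη-reduction: `(λx. s) t → s[t/x]` and, for `x` not free in `s`, `λx. s x → s`,
in arbitrary contexts. -/
inductive Step : Lam → Lam → Prop where
  | beta (s t : Lam) : Step (app (lam s) t) (subst (single t) s)
  | eta (s : Lam) : Step (lam (app (shift s) (var 0))) s
  | appLeft {s s' : Lam} (t : Lam) : Step s s' → Step (app s t) (app s' t)
  | appRight (s : Lam) {t t' : Lam} : Step t t' → Step (app s t) (app s t')
  | lam {s s' : Lam} : Step s s' → Step (lam s) (lam s')

/-- βη-equivalence: the equivalence relation generated by one-step βη-reduction. -/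
def BetaEtaEq : Lam → Lam → Prop := Relation.EqvGen Step

end Lam

/-- `B`-terms: the terms built from the constant `B` alone by application. -/
inductive BTerm : Type where
  | B : BTerm
  | app : BTerm → BTerm → BTerm

namespace BTerm

/-- The λ-term of a `B`-term, obtained by replacing `B` with `λx. λy. λz. x (y z)`. -/
def toLam : BTerm → Lam
  | B => .lam (.lam (.lam (.app (.var 2) (.app (.var 1) (.var 0)))))
  | app e₁ e₂ => .app (toLam e₁) (toLam e₂)

/-- Equality of `B`-terms derivable in equational logic (reflexivity, symmetry, transitivity,
replacement under application) from all instances of the three equations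
`B x y z = x (y z)`, `B (B x y) = B (B x) (B y)` and `B B (B x) = B (B (B x)) B`. -/
inductive Derivable : BTerm → BTerm → Prop where
  | b1 (x y z : BTerm) :
      Derivable (app (app (app B x) y) z) (app x (app y z))
  | b2 (x y : BTerm) :
      Derivable (app B (app (app B x) y)) (app (app B (app B x)) (app B y))
  | b3 (x : BTerm) :
      Derivable (app (app B B) (app B x)) (app (app B (app B (app B x))) B)
  | refl (e : BTerm) : Derivable e e
  | symm {e₁ e₂ : BTerm} : Derivable e₁ e₂ → Derivable e₂ e₁
  | trans {e₁ e₂ e₃ : BTerm} : Derivable e₁ e₂ → Derivable e₂ e₃ → Derivable e₁ e₃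
  | app {e₁ e₁' e₂ e₂' : BTerm} :
      Derivable e₁ e₁' → Derivable e₂ e₂' → Derivable (app e₁ e₂) (app e₁' e₂')

end BTerm

/-!
Write `x ∘ y` for `B x y` and `b k` for `B (B (… (B B)))` with `k` outer `B`s. The second equation
makes `∘` associative and `B (-)` a homomorphism for it, and the third one yields
`b i ∘ b j = b (j + 1) ∘ b i` for `i < j`: the relations of the positive monoid of Thompson's
group `F`. Hence every `B`-term is derivably equal to a product of `b k`s whose indices decrease
weakly from left to right (`BTerm.exists_poly`).

Conversely such a product can be read off from its λ-term. Applied to a head variable `f` and to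
sufficiently many arguments `x₀, x₁, …`, the term `b k` replaces the arguments `x k` and `x (k + 1)`
by the single argument `x k x (k + 1)` (`Lam.merge`), so a product turns the sequence of variables
into a forest, and `f` applied to that forest is a βη-normal form (`Lam.apps_poly`). If the indices
are decreasing, the last factor is the position of the first tree of the forest that is not a
variable; undoing that merge recovers the other factors (`Lam.merges_injective`).

What remains is that βη-equivalent normal forms are equal. The Church–Rosser property
(`Lam.betaEtaEq_join`) is obtained as in the Hindley–Rosen lemma: parallel β-reduction has the
diamond property, single η-steps commute up to at most one step, and the two relations commute.
-/

namespace Lam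

/-! ### Renaming and substitution -/

theorem liftRen_comp (ξ ζ : ℕ → ℕ) : liftRen (ξ ∘ ζ) = liftRen ξ ∘ liftRen ζ := by
  funext n; cases n <;> rfl

theorem rename_rename (ξ ζ : ℕ → ℕ) (t : Lam) : rename ξ (rename ζ t) = rename (ξ ∘ ζ) t := by
  induction t generalizing ξ ζ with
  | var n => rfl
  | app s t hs ht => simp [rename, hs, ht]
  | lam s hs => simp [rename, hs, liftRen_comp]

theorem shift_rename (ξ : ℕ → ℕ) (t : Lam) : shift (rename ξ t) = rename (liftRen ξ) (shift t) := by
  simp only [shift, rename_rename]; rfl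

theorem subst_rename (σ : ℕ → Lam) (ξ : ℕ → ℕ) (t : Lam) :
    subst σ (rename ξ t) = subst (σ ∘ ξ) t := by
  induction t generalizing σ ξ with
  | var n => rfl
  | app s t hs ht => simp [rename, subst, hs, ht]
  | lam s hs =>
    have : liftSub σ ∘ liftRen ξ = liftSub (σ ∘ ξ) := by funext n; cases n <;> rfl
    simp [rename, subst, hs, this]

theorem rename_subst (ξ : ℕ → ℕ) (σ : ℕ → Lam) (t : Lam) :
    rename ξ (subst σ t) = subst (rename ξ ∘ σ) t := by
  induction t generalizing σ ξ with
  | var n => rfl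
  | app s t hs ht => simp [rename, subst, hs, ht]
  | lam s hs =>
    have : rename (liftRen ξ) ∘ liftSub σ = liftSub (rename ξ ∘ σ) := by
      funext n
      cases n with
      | zero => rfl
      | succ n => simp [liftSub, shift_rename]
    simp [rename, subst, hs, this]

theorem shift_subst (σ : ℕ → Lam) (t : Lam) :
    shift (subst σ t) = subst (liftSub σ) (shift t) := by
  simp only [shift, rename_subst, subst_rename]; rfl

theorem subst_subst (τ σ : ℕ → Lam) (t : Lam) :
    subst τ (subst σ t) = subst (subst τ ∘ σ) t := by
  induction t generalizing σ τ with
  | var n => rfl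
  | app s t hs ht => simp [subst, hs, ht]
  | lam s hs =>
    have : subst (liftSub τ) ∘ liftSub σ = liftSub (subst τ ∘ σ) := by
      funext n
      cases n with
      | zero => rfl
      | succ n => simp [liftSub, shift_subst]
    simp [subst, hs, this]

theorem subst_var (t : Lam) : subst var t = t := by
  induction t with
  | var n => rfl
  | app s t hs ht => simp [subst, hs, ht]
  | lam s hs =>
    have : liftSub var = var := by funext n; cases n <;> rfl
    simp [subst, hs, this]

theorem subst_single_shift (s t : Lam) : subst (single t) (shift s) = s := by
  rw [shift, subst_rename]; exact subst_var s

theorem subst_single_var_zero (s : Lam) :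
    subst (single (var 0)) (rename (liftRen Nat.succ) s) = s := by
  rw [subst_rename]
  have : single (var 0) ∘ liftRen Nat.succ = var := by funext n; cases n <;> rfl
  rw [this, subst_var]

theorem shift_injective : Function.Injective shift := fun s t h => by
  rw [← subst_single_shift s (var 0), h, subst_single_shift]

theorem subst_subst_single (σ : ℕ → Lam) (s t : Lam) :
    subst σ (subst (single t) s) = subst (single (subst σ t)) (subst (liftSub σ) s) := by
  rw [subst_subst, subst_subst]
  congr 1
  funext n
  cases n with
  | zero => rfl
  | succ n => exact (subst_single_shift _ _).symm

theorem rename_subst_single (ξ : ℕ → ℕ) (s t : Lam) :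
    rename ξ (subst (single t) s) = subst (single (rename ξ t)) (rename (liftRen ξ) s) := by
  rw [rename_subst, subst_rename]
  congr 1
  funext n
  cases n <;> rfl

/-- Renaming preserves weak pullbacks: two renamings of terms that agree come from a common term
as soon as this is so for variables. -/
theorem exists_of_rename_eq_rename {f g p q : ℕ → ℕ}
    (h : ∀ i j, f i = g j → ∃ k, i = p k ∧ j = q k) {s t : Lam} (e : rename f s = rename g t) :
    ∃ r, s = rename p r ∧ t = rename q r := by
  induction s generalizing f g p q t with
  | var i =>
    cases t with
    | var j =>
      obtain ⟨k, hi, hj⟩ := h i j (by simpa [rename] using e)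
      exact ⟨var k, by rw [hi]; rfl, by rw [hj]; rfl⟩
    | app _ _ => simp [rename] at e
    | lam _ => simp [rename] at e
  | app s₁ s₂ h₁ h₂ =>
    cases t with
    | app t₁ t₂ =>
      simp only [rename, app.injEq] at e
      obtain ⟨r₁, rfl, rfl⟩ := h₁ h e.1
      obtain ⟨r₂, rfl, rfl⟩ := h₂ h e.2
      exact ⟨app r₁ r₂, rfl, rfl⟩
    | var _ => simp [rename] at e
    | lam _ => simp [rename] at e
  | lam s hs =>
    cases t with
    | lam t =>
      simp only [rename, lam.injEq] at e
      have h' : ∀ i j, liftRen f i = liftRen g j → ∃ k, i = liftRen p k ∧ j = liftRen q k := by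
        rintro (_ | i) (_ | j) hij
        · exact ⟨0, rfl, rfl⟩
        · simp [liftRen] at hij
        · simp [liftRen] at hij
        · obtain ⟨k, rfl, rfl⟩ := h i j (by simpa [liftRen] using hij)
          exact ⟨k + 1, rfl, rfl⟩
      obtain ⟨r, rfl, rfl⟩ := hs h' e
      exact ⟨lam r, rfl, rfl⟩
    | var _ => simp [rename] at e
    | app _ _ => simp [rename] at e

theorem exists_of_rename_liftRen_eq_shift {ξ : ℕ → ℕ} {s t : Lam}
    (e : rename (liftRen ξ) s = shift t) : ∃ r, s = shift r ∧ t = rename ξ r := by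
  refine exists_of_rename_eq_rename (fun i j hij => ?_) e
  cases i with
  | zero => simp [liftRen] at hij
  | succ i => exact ⟨i, rfl, by simpa [liftRen] using hij.symm⟩

/-! ### Parallel β-reduction -/

/-- Parallel β-reduction: any set of the β-redexes present in a term is contracted at once. -/
inductive Par : Lam → Lam → Prop where
  | var (n : ℕ) : Par (var n) (var n)
  | app {s s' t t' : Lam} : Par s s' → Par t t' → Par (app s t) (app s' t')
  | lam {s s' : Lam} : Par s s' → Par (lam s) (lam s')
  | beta {s s' t t' : Lam} : Par s s' → Par t t' → Par (app (lam s) t) (subst (single t') s')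

theorem Par.refl (t : Lam) : Par t t := by
  induction t with
  | var n => exact .var n
  | app _ _ hs ht => exact .app hs ht
  | lam _ hs => exact .lam hs

theorem Par.rename {s s' : Lam} (h : Par s s') (ξ : ℕ → ℕ) :
    Par (s.rename ξ) (s'.rename ξ) := by
  induction h generalizing ξ with
  | var n => exact .var _
  | app _ _ hs ht => exact .app (hs ξ) (ht ξ)
  | lam _ hs => exact .lam (hs _)
  | beta _ _ hs ht => rw [rename_subst_single]; exact .beta (hs _) (ht ξ)

theorem Par.liftSub {σ τ : ℕ → Lam} (h : ∀ n, Par (σ n) (τ n)) (n : ℕ) :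
    Par (liftSub σ n) (liftSub τ n) := by
  cases n with
  | zero => exact .var 0
  | succ n => exact (h n).rename _

theorem Par.subst {s s' : Lam} (h : Par s s') {σ τ : ℕ → Lam} (hσ : ∀ n, Par (σ n) (τ n)) :
    Par (s.subst σ) (s'.subst τ) := by
  induction h generalizing σ τ with
  | var n => exact hσ n
  | app _ _ hs ht => exact .app (hs hσ) (ht hσ)
  | lam _ hs => exact .lam (hs (Par.liftSub hσ))
  | beta _ _ hs ht => rw [subst_subst_single]; exact .beta (hs (Par.liftSub hσ)) (ht hσ)

theorem Par.subst_single {s s' t t' : Lam} (hs : Par s s') (ht : Par t t') :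
    Par (s.subst (single t)) (s'.subst (single t')) := by
  refine hs.subst fun n => ?_
  cases n with
  | zero => exact ht
  | succ n => exact .var n

theorem Par.exists_of_rename {ξ : ℕ → ℕ} {s t : Lam} (h : Par (s.rename ξ) t) :
    ∃ t', t = t'.rename ξ ∧ Par s t' := by
  generalize e : s.rename ξ = u at h
  induction h generalizing s ξ with
  | var n =>
    cases s <;> simp only [Lam.rename, reduceCtorEq] at e
    exact ⟨.var _, e.symm, .var _⟩
  | app _ _ hs ht =>
    cases s <;> simp only [Lam.rename, reduceCtorEq, Lam.app.injEq] at e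
    obtain ⟨a, rfl, ha⟩ := hs e.1
    obtain ⟨b, rfl, hb⟩ := ht e.2
    exact ⟨_, rfl, .app ha hb⟩
  | lam _ hs =>
    cases s <;> simp only [Lam.rename, reduceCtorEq, Lam.lam.injEq] at e
    obtain ⟨a, rfl, ha⟩ := hs e
    exact ⟨_, rfl, .lam ha⟩
  | beta _ _ hs ht =>
    cases s with
    | app s₁ s₂ =>
      simp only [Lam.rename, Lam.app.injEq] at e
      obtain ⟨e₁, e₂⟩ := e
      cases s₁ <;> simp only [Lam.rename, reduceCtorEq, Lam.lam.injEq] at e₁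
      obtain ⟨a, rfl, ha⟩ := hs e₁
      obtain ⟨b, rfl, hb⟩ := ht e₂
      exact ⟨_, (rename_subst_single _ _ _).symm, .beta ha hb⟩
    | var _ => simp [Lam.rename] at e
    | lam _ => simp [Lam.rename] at e

theorem Par.diamond {s t u : Lam} (ht : Par s t) (hu : Par s u) : ∃ v, Par t v ∧ Par u v := by
  induction ht generalizing u with
  | var n => exact ⟨u, hu, .refl u⟩
  | lam _ ih =>
    cases hu with
    | lam h =>
      obtain ⟨v, h₁, h₂⟩ := ih h
      exact ⟨_, .lam h₁, .lam h₂⟩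
  | app h₁ h₂ ih₁ ih₂ =>
    cases hu with
    | app k₁ k₂ =>
      obtain ⟨v, a₁, a₂⟩ := ih₁ k₁
      obtain ⟨w, b₁, b₂⟩ := ih₂ k₂
      exact ⟨_, .app a₁ b₁, .app a₂ b₂⟩
    | beta k₁ k₂ =>
      obtain ⟨v, a₁, a₂⟩ := ih₁ (.lam k₁)
      obtain ⟨w, b₁, b₂⟩ := ih₂ k₂
      cases h₁
      cases a₁ with
      | lam a₁ =>
        cases a₂ with
        | lam a₂ => exact ⟨_, .beta a₁ b₁, a₂.subst_single b₂⟩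
  | beta h₁ h₂ ih₁ ih₂ =>
    cases hu with
    | app k₁ k₂ =>
      cases k₁ with
      | lam k₁ =>
        obtain ⟨v, a₁, a₂⟩ := ih₁ k₁
        obtain ⟨w, b₁, b₂⟩ := ih₂ k₂
        exact ⟨_, a₁.subst_single b₁, .beta a₂ b₂⟩
    | beta k₁ k₂ =>
      obtain ⟨v, a₁, a₂⟩ := ih₁ k₁
      obtain ⟨w, b₁, b₂⟩ := ih₂ k₂
      exact ⟨_, a₁.subst_single b₁, a₂.subst_single b₂⟩

/-! ### η-reduction -/

/-- One-step η-reduction in arbitrary contexts. -/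
inductive Eta : Lam → Lam → Prop where
  | eta (s : Lam) : Eta (lam (app (shift s) (var 0))) s
  | appLeft {s s' : Lam} (t : Lam) : Eta s s' → Eta (app s t) (app s' t)
  | appRight (s : Lam) {t t' : Lam} : Eta t t' → Eta (app s t) (app s t')
  | lam {s s' : Lam} : Eta s s' → Eta (lam s) (lam s')

/-- The reflexive transitive closure of one-step η-reduction. -/
abbrev Etas : Lam → Lam → Prop := Relation.ReflTransGen Eta

theorem Eta.subst {s s' : Lam} (h : Eta s s') (σ : ℕ → Lam) : Eta (s.subst σ) (s'.subst σ) := by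
  induction h generalizing σ with
  | eta s =>
    have := Eta.eta (s.subst σ)
    rwa [shift_subst] at this
  | appLeft t _ ih => exact .appLeft _ (ih σ)
  | appRight s _ ih => exact .appRight _ (ih σ)
  | lam _ ih => exact .lam (ih _)

theorem Eta.rename {s s' : Lam} (h : Eta s s') (ξ : ℕ → ℕ) : Eta (s.rename ξ) (s'.rename ξ) := by
  induction h generalizing ξ with
  | eta s =>
    have := Eta.eta (s.rename ξ)
    rwa [shift_rename] at this
  | appLeft t _ ih => exact .appLeft _ (ih ξ)
  | appRight s _ ih => exact .appRight _ (ih ξ)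
  | lam _ ih => exact .lam (ih _)

theorem Etas.app {s s' t t' : Lam} (hs : Etas s s') (ht : Etas t t') :
    Etas (app s t) (app s' t') :=
  (hs.lift (fun s => Lam.app s t) fun _ _ h => .appLeft t h).trans
    (ht.lift (fun t => Lam.app s' t) fun _ _ h => .appRight s' h)

theorem Etas.lam {s s' : Lam} (hs : Etas s s') : Etas (lam s) (lam s') :=
  hs.lift Lam.lam fun _ _ h => .lam h

theorem Etas.subst_right {σ τ : ℕ → Lam} (h : ∀ n, Etas (σ n) (τ n)) (s : Lam) :
    Etas (s.subst σ) (s.subst τ) := by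
  induction s generalizing σ τ with
  | var n => exact h n
  | app _ _ hs ht => exact (hs h).app (ht h)
  | lam _ hs =>
    refine (hs fun n => ?_).lam
    cases n with
    | zero => exact .refl
    | succ n => exact (h n).lift shift fun _ _ h => h.rename _

theorem Etas.subst_single {s s' t t' : Lam} (hs : Etas s s') (ht : Etas t t') :
    Etas (s.subst (single t)) (s'.subst (single t')) := by
  refine (hs.lift (Lam.subst (single t)) fun _ _ h => h.subst _).trans
    (Etas.subst_right (fun n => ?_) s')
  cases n with
  | zero => exact ht
  | succ n => exact .refl

theorem Eta.exists_of_rename {ξ : ℕ → ℕ} {s t : Lam} (h : Eta (s.rename ξ) t) :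
    ∃ t', t = t'.rename ξ ∧ Eta s t' := by
  generalize e : s.rename ξ = u at h
  induction h generalizing s ξ with
  | eta r =>
    cases s with
    | lam s =>
      simp only [Lam.rename, Lam.lam.injEq] at e
      cases s with
      | app s₁ s₂ =>
        simp only [Lam.rename, Lam.app.injEq] at e
        obtain ⟨e₁, e₂⟩ := e
        obtain ⟨q, rfl, rfl⟩ := exists_of_rename_liftRen_eq_shift e₁
        cases s₂ with
        | var n =>
          cases n with
          | zero => exact ⟨q, rfl, .eta q⟩
          | succ n => simp [Lam.rename, liftRen] at e₂
        | app _ _ => simp [Lam.rename] at e₂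
        | lam _ => simp [Lam.rename] at e₂
      | var _ => simp [Lam.rename] at e
      | lam _ => simp [Lam.rename] at e
    | var _ => simp [Lam.rename] at e
    | app _ _ => simp [Lam.rename] at e
  | appLeft _ _ ih =>
    cases s <;> simp only [Lam.rename, reduceCtorEq, Lam.app.injEq] at e
    obtain ⟨a, rfl, ha⟩ := ih e.1
    exact ⟨.app a _, by rw [← e.2]; rfl, .appLeft _ ha⟩
  | appRight _ _ ih =>
    cases s <;> simp only [Lam.rename, reduceCtorEq, Lam.app.injEq] at e
    obtain ⟨a, rfl, ha⟩ := ih e.2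
    exact ⟨.app _ a, by rw [← e.1]; rfl, .appRight _ ha⟩
  | lam _ ih =>
    cases s <;> simp only [Lam.rename, reduceCtorEq, Lam.lam.injEq] at e
    obtain ⟨a, rfl, ha⟩ := ih e
    exact ⟨_, rfl, .lam ha⟩

/-- An η-redex and an η-step inside it commute, since the step takes place in the shifted part. -/
theorem Eta.lam_app_shift {r s' : Lam} (h : Eta (Lam.app (shift r) (Lam.var 0)) s') :
    ∃ r', s' = Lam.app (shift r') (Lam.var 0) ∧ Eta r r' := by
  cases h with
  | appLeft _ h =>
    obtain ⟨r', rfl, hr⟩ := h.exists_of_rename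
    exact ⟨r', rfl, hr⟩
  | appRight _ h => cases h

theorem Eta.subcommute {s t u : Lam} (ht : Eta s t) (hu : Eta s u) :
    ∃ v, Relation.ReflGen Eta t v ∧ Relation.ReflGen Eta u v := by
  induction ht generalizing u with
  | eta r =>
    generalize e : Lam.lam (Lam.app (shift r) (Lam.var 0)) = q at hu
    cases hu with
    | eta r' =>
      simp only [Lam.lam.injEq, Lam.app.injEq, and_true] at e
      obtain rfl := shift_injective e
      exact ⟨r, .refl, .refl⟩
    | lam h =>
      simp only [Lam.lam.injEq] at e
      subst e
      obtain ⟨r', rfl, hr⟩ := h.lam_app_shift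
      exact ⟨r', .single hr, .single (.eta r')⟩
    | appLeft _ _ => simp at e
    | appRight _ _ => simp at e
  | appLeft t h ih =>
    cases hu with
    | appLeft _ k =>
      obtain ⟨v, h₁, h₂⟩ := ih k
      exact ⟨.app v t, h₁.rec .refl fun h => .single (.appLeft _ h),
        h₂.rec .refl fun h => .single (.appLeft _ h)⟩
    | appRight _ k => exact ⟨_, .single (.appRight _ k), .single (.appLeft _ h)⟩
  | appRight s h ih =>
    cases hu with
    | appLeft _ k => exact ⟨_, .single (.appLeft _ k), .single (.appRight _ h)⟩
    | appRight _ k =>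
      obtain ⟨v, h₁, h₂⟩ := ih k
      exact ⟨.app s v, h₁.rec .refl fun h => .single (.appRight _ h),
        h₂.rec .refl fun h => .single (.appRight _ h)⟩
  | lam h ih =>
    rename_i a b
    generalize e : Lam.lam a = q at hu
    cases hu with
    | eta r =>
      simp only [Lam.lam.injEq] at e
      subst e
      obtain ⟨r', rfl, hr⟩ := h.lam_app_shift
      exact ⟨r', .single (.eta r'), .single hr⟩
    | lam k =>
      simp only [Lam.lam.injEq] at e
      subst e
      obtain ⟨v, h₁, h₂⟩ := ih k
      exact ⟨.lam v, h₁.rec .refl fun h => .single (.lam h),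
        h₂.rec .refl fun h => .single (.lam h)⟩
    | appLeft _ _ => simp at e
    | appRight _ _ => simp at e

/-! ### Commutation and the Church–Rosser property -/

/-- A parallel β-step on the body of an η-redex `λx. r x` either takes place in `r`, or also
contracts `r x`, where `r` is an abstraction; then the result is what a step from `r` gives. -/
theorem Par.app_shift {r s' : Lam} (h : Par (Lam.app (shift r) (Lam.var 0)) s') :
    (∃ r', s' = Lam.app (shift r') (Lam.var 0) ∧ Par r r') ∨
      ∃ q, r = Lam.lam q ∧ Par q s' := by
  generalize e : shift r = p at h
  cases h with
  | app h₁ h₂ =>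
    subst e
    obtain ⟨r', rfl, hr⟩ := h₁.exists_of_rename
    cases h₂
    exact .inl ⟨r', rfl, hr⟩
  | beta h₁ h₂ =>
    cases r <;> simp only [shift, Lam.rename, reduceCtorEq, Lam.lam.injEq] at e
    subst e
    obtain ⟨q', rfl, hq⟩ := h₁.exists_of_rename
    cases h₂
    exact .inr ⟨_, rfl, by rwa [subst_single_var_zero]⟩

theorem Par.commute_eta {s t u : Lam} (ht : Par s t) (hu : Eta s u) :
    ∃ v, Etas t v ∧ Par u v := by
  induction ht generalizing u with
  | var n => cases hu
  | app h₁ h₂ ih₁ ih₂ =>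
    cases hu with
    | appLeft _ k =>
      obtain ⟨v, a, b⟩ := ih₁ k
      exact ⟨_, a.app .refl, .app b h₂⟩
    | appRight _ k =>
      obtain ⟨v, a, b⟩ := ih₂ k
      exact ⟨_, Etas.app .refl a, .app h₁ b⟩
  | lam h ih =>
    rename_i a b
    generalize e : Lam.lam a = q at hu
    cases hu with
    | eta r =>
      simp only [Lam.lam.injEq] at e
      subst e
      obtain ⟨r', rfl, hr⟩ | ⟨q, rfl, hq⟩ := h.app_shift
      · exact ⟨r', .single (.eta r'), hr⟩
      · exact ⟨_, .refl, .lam hq⟩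
    | lam k =>
      simp only [Lam.lam.injEq] at e
      subst e
      obtain ⟨v, h₁, h₂⟩ := ih k
      exact ⟨_, h₁.lam, .lam h₂⟩
    | appLeft _ _ => simp at e
    | appRight _ _ => simp at e
  | beta h₁ h₂ ih₁ ih₂ =>
    rename_i a a' b b'
    cases hu with
    | appLeft _ k =>
      generalize e : Lam.lam a = q at k
      cases k with
      | eta r =>
        simp only [Lam.lam.injEq] at e
        subst e
        obtain ⟨r', rfl, hr⟩ | ⟨q, rfl, hq⟩ := h₁.app_shift
        · refine ⟨Lam.app r' b', ?_, .app hr h₂⟩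
          rw [Lam.subst, subst_single_shift]
          exact .refl
        · exact ⟨_, .refl, .beta hq h₂⟩
      | lam k =>
        simp only [Lam.lam.injEq] at e
        subst e
        obtain ⟨v, k₁, k₂⟩ := ih₁ k
        exact ⟨_, k₁.subst_single .refl, .beta k₂ h₂⟩
      | appLeft _ _ => simp at e
      | appRight _ _ => simp at e
    | appRight _ k =>
      obtain ⟨v, k₁, k₂⟩ := ih₂ k
      exact ⟨_, Etas.subst_single .refl k₁, .beta h₁ k₂⟩

/-- The reflexive transitive closure of parallel β-reduction. -/
abbrev Pars : Lam → Lam → Prop := Relation.ReflTransGen Par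

theorem Pars.commute_etas {s t u : Lam} (ht : Pars s t) (hu : Etas s u) :
    ∃ v, Etas t v ∧ Pars u v := by
  have strip : ∀ {s t u : Lam}, Par s t → Etas s u → ∃ v, Etas t v ∧ Par u v := by
    intro s t u ht hu
    induction hu with
    | refl => exact ⟨t, .refl, ht⟩
    | tail _ h ih =>
      obtain ⟨v, h₁, h₂⟩ := ih
      obtain ⟨w, k₁, k₂⟩ := h₂.commute_eta h
      exact ⟨w, h₁.trans k₁, k₂⟩
  induction ht with
  | refl => exact ⟨u, hu, .refl⟩
  | tail _ h ih =>
    obtain ⟨v, h₁, h₂⟩ := ih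
    obtain ⟨w, k₁, k₂⟩ := strip h h₁
    exact ⟨w, k₁, h₂.tail k₂⟩

/-- βη-reduction organised as a sequence of parallel β-steps followed by η-steps. In this form it
has the diamond property. -/
def ParsEtas : Lam → Lam → Prop := Relation.Comp Pars Etas

theorem ParsEtas.diamond {s t u : Lam} (ht : ParsEtas s t) (hu : ParsEtas s u) :
    ∃ v, ParsEtas t v ∧ ParsEtas u v := by
  obtain ⟨a, ha, hat⟩ := ht
  obtain ⟨b, hb, hbu⟩ := hu
  obtain ⟨c, hac, hbc⟩ : Relation.Join Pars a b := Relation.church_rosser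
    (fun _ _ _ h k => let ⟨v, h₁, h₂⟩ := Par.diamond h k; ⟨v, .single h₁, .single h₂⟩) ha hb
  obtain ⟨d, hcd, htd⟩ := hac.commute_etas hat
  obtain ⟨d', hcd', hud'⟩ := hbc.commute_etas hbu
  obtain ⟨v, hdv, hdv'⟩ : Relation.Join Etas d d' := Relation.church_rosser
    (fun _ _ _ h k => let ⟨v, h₁, h₂⟩ := Eta.subcommute h k; ⟨v, h₁, h₂.to_reflTransGen⟩) hcd hcd'
  exact ⟨v, ⟨d, htd, hdv⟩, ⟨d', hud', hdv'⟩⟩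

theorem Step.par_or_eta {s t : Lam} (h : Step s t) : Par s t ∨ Eta s t := by
  induction h with
  | beta s t => exact .inl (.beta (.refl s) (.refl t))
  | eta s => exact .inr (.eta s)
  | appLeft t _ ih => exact ih.imp (fun h => .app h (.refl t)) (.appLeft t)
  | appRight s _ ih => exact ih.imp (fun h => .app (.refl s) h) (.appRight s)
  | lam _ ih => exact ih.imp .lam .lam

theorem Step.parsEtas {s t : Lam} (h : Step s t) : ParsEtas s t :=
  h.par_or_eta.elim (fun h => ⟨t, .single h, .refl⟩) (fun h => ⟨s, .refl, .single h⟩)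

/-- The Church–Rosser property of βη-reduction. -/
theorem betaEtaEq_join {s t : Lam} (h : BetaEtaEq s t) :
    Relation.Join (Relation.ReflTransGen ParsEtas) s t := by
  have hE := Relation.equivalence_join_reflTransGen (r := ParsEtas)
    fun _ _ _ h k => let ⟨v, h₁, h₂⟩ := ParsEtas.diamond h k; ⟨v, .single h₁, .single h₂⟩
  induction h with
  | rel s t h => exact ⟨t, .single h.parsEtas, .refl⟩
  | refl s => exact hE.refl s
  | symm s t _ ih => exact hE.symm ih
  | trans s t u _ _ h₁ h₂ => exact hE.trans h₁ h₂

/-- Terms built from variables by application only. They contain no redex. -/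
inductive LamFree : Lam → Prop where
  | var (n : ℕ) : LamFree (var n)
  | app {s t : Lam} : LamFree s → LamFree t → LamFree (app s t)

theorem LamFree.eq_of_par {s t : Lam} (hs : LamFree s) (h : Par s t) : t = s := by
  induction hs generalizing t with
  | var n => cases h; rfl
  | app h₁ h₂ ih₁ ih₂ =>
    cases h with
    | app k₁ k₂ => rw [ih₁ k₁, ih₂ k₂]
    | beta _ _ => cases h₁

theorem LamFree.not_eta {s t : Lam} (hs : LamFree s) : ¬ Eta s t := by
  induction hs generalizing t with
  | var n => intro h; cases h
  | app h₁ h₂ ih₁ ih₂ =>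
    intro h
    cases h with
    | appLeft _ k => exact ih₁ k
    | appRight _ k => exact ih₂ k

theorem LamFree.eq_of_parsEtas {s t : Lam} (hs : LamFree s) (h : ParsEtas s t) : t = s := by
  obtain ⟨a, ha, hat⟩ := h
  have e : a = s := by
    clear hat
    induction ha with
    | refl => rfl
    | tail _ h ih =>
      subst ih
      exact hs.eq_of_par h
  subst e
  cases hat.cases_head with
  | inl h => exact h.symm
  | inr h => exact (hs.not_eta h.choose_spec.1).elim

theorem LamFree.eq_of_betaEtaEq {s t : Lam} (hs : LamFree s) (ht : LamFree t)
    (h : BetaEtaEq s t) : s = t := by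
  obtain ⟨u, hsu, htu⟩ := betaEtaEq_join h
  have key : ∀ {s : Lam}, LamFree s → Relation.ReflTransGen ParsEtas s u → u = s := by
    clear hsu htu
    intro s hs h
    induction h with
    | refl => rfl
    | tail _ h ih =>
      subst ih
      exact hs.eq_of_parsEtas h
  rw [← key hs hsu, key ht htu]

/-! ### βη-equivalence of `B`-terms -/

namespace BetaEtaEq

theorem refl (s : Lam) : BetaEtaEq s s := Relation.EqvGen.refl s

theorem symm {s t : Lam} (h : BetaEtaEq s t) : BetaEtaEq t s := Relation.EqvGen.symm _ _ h

theorem trans {s t u : Lam} (h : BetaEtaEq s t) (k : BetaEtaEq t u) : BetaEtaEq s u :=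
  Relation.EqvGen.trans _ _ _ h k

theorem map {f : Lam → Lam} (hf : ∀ s t, Step s t → Step (f s) (f t)) {s t : Lam}
    (h : BetaEtaEq s t) : BetaEtaEq (f s) (f t) := by
  induction h with
  | rel _ _ h => exact .rel _ _ (hf _ _ h)
  | refl _ => exact .refl _
  | symm _ _ _ ih => exact ih.symm
  | trans _ _ _ _ _ h k => exact h.trans k

theorem app {s s' t t' : Lam} (hs : BetaEtaEq s s') (ht : BetaEtaEq t t') :
    BetaEtaEq (app s t) (app s' t') :=
  (hs.map (f := (Lam.app · t)) fun _ _ h => .appLeft t h).trans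
    (ht.map (f := Lam.app s') fun _ _ h => .appRight s' h)

theorem ext {s t : Lam}
    (h : BetaEtaEq (Lam.app (shift s) (var 0)) (Lam.app (shift t) (var 0))) : BetaEtaEq s t :=
  (BetaEtaEq.symm (.rel _ _ (.eta s))).trans
    ((h.map (f := Lam.lam) fun _ _ h => .lam h).trans (.rel _ _ (.eta t)))

end BetaEtaEq

/-- The λ-term `λx. λy. λz. x (y z)` of the constant `B`. -/
abbrev B : Lam := BTerm.toLam .B

theorem betaEtaEq_B (x y z : Lam) :
    BetaEtaEq (app (app (app B x) y) z) (app x (app y z)) := by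
  refine ((BetaEtaEq.app (BetaEtaEq.app (.rel _ _ (.beta _ x)) (.refl y)) (.refl z)).trans
    ((BetaEtaEq.app (.rel _ _ (.beta _ y)) (.refl z)).trans (.rel _ _ ?_)))
  have h : ∀ s : Lam, subst (liftSub (single y)) (shift (shift s)) = shift s := fun s => by
    rw [← shift_subst, subst_single_shift]
  have hz := Step.beta (app (shift x) (app (shift y) (var 0))) z
  simp only [subst, subst_single_shift] at hz
  rw [← h x] at hz
  exact hz

theorem shift_B : shift B = B := rfl

theorem shift_app (s t : Lam) : shift (app s t) = app (shift s) (shift t) := rfl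

theorem betaEtaEq_B_comp (x y : Lam) :
    BetaEtaEq (app B (app (app B x) y)) (app (app B (app B x)) (app B y)) := by
  refine .ext (.ext ?_)
  simp only [shift_app, shift_B]
  refine (betaEtaEq_B _ _ _).trans ((betaEtaEq_B _ _ _).trans ?_)
  refine .trans ?_ (BetaEtaEq.app (betaEtaEq_B _ _ _).symm (.refl _))
  refine .trans ?_ (betaEtaEq_B _ _ _).symm
  exact .app (.refl _) (betaEtaEq_B _ _ _).symm

theorem betaEtaEq_B_B (x : Lam) :
    BetaEtaEq (app (app B B) (app B x)) (app (app B (app B (app B x))) B) := by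
  refine .ext (.ext (.ext ?_))
  simp only [shift_app, shift_B]
  generalize shift (shift (shift x)) = x
  generalize shift (shift (var 0)) = u
  generalize shift (var 0) = v
  have hl : BetaEtaEq (app (app (app (app (app B B) (app B x)) u) v) (var 0))
      (app x (app u (app v (var 0)))) :=
    (BetaEtaEq.app (.app (betaEtaEq_B _ _ _) (.refl _)) (.refl _)).trans
      ((betaEtaEq_B _ _ _).trans (betaEtaEq_B _ _ _))
  have hr : BetaEtaEq (app (app (app (app (app B (app B (app B x))) B) u) v) (var 0))
      (app x (app u (app v (var 0)))) :=
    (BetaEtaEq.app (.app (betaEtaEq_B _ _ _) (.refl _)) (.refl _)).trans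
      ((BetaEtaEq.app (betaEtaEq_B _ _ _) (.refl _)).trans
        ((betaEtaEq_B _ _ _).trans (.app (.refl _) (betaEtaEq_B _ _ _))))
  exact hl.trans hr.symm

end Lam

namespace BTerm

theorem Derivable.betaEtaEq {e₁ e₂ : BTerm} (h : Derivable e₁ e₂) :
    Lam.BetaEtaEq e₁.toLam e₂.toLam := by
  induction h with
  | b1 x y z => exact Lam.betaEtaEq_B _ _ _
  | b2 x y => exact Lam.betaEtaEq_B_comp _ _
  | b3 x => exact Lam.betaEtaEq_B_B _
  | refl e => exact .refl _
  | symm _ ih => exact ih.symm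
  | trans _ _ ih₁ ih₂ => exact ih₁.trans ih₂
  | app _ _ ih₁ ih₂ => exact ih₁.app ih₂

/-! ### Decreasing products -/

/-- The composition `x ∘ y` of `B`-terms. -/
def comp (x y : BTerm) : BTerm := app (app B x) y

/-- The term `B (B (… (B B)))` with `k` outer applications of `B`. -/
def mono : ℕ → BTerm
  | 0 => B
  | k + 1 => app B (mono k)

/-- The product of the terms `mono` of the indices in the nonempty list `k :: M`, in reverse order:
`k` is the index of the rightmost factor. A product with weakly decreasing indices thus
corresponds to a weakly increasing list. -/
def poly (k : ℕ) : List ℕ → BTerm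
  | [] => mono k
  | j :: M => comp (poly j M) (mono k)

namespace Derivable

theorem comp {x x' y y' : BTerm} (hx : Derivable x x') (hy : Derivable y y') :
    Derivable (comp x y) (comp x' y') := .app (.app (.refl B) hx) hy

theorem comp_assoc (x y z : BTerm) :
    Derivable (BTerm.comp (BTerm.comp x y) z) (BTerm.comp x (BTerm.comp y z)) :=
  (Derivable.app (.b2 x y) (.refl z)).trans (.b1 _ _ _)

/-- The relations of the positive monoid of Thompson's group. -/
theorem mono_comp_mono {i j : ℕ} (h : i < j) :
    Derivable (BTerm.comp (mono i) (mono j)) (BTerm.comp (mono (j + 1)) (mono i)) := by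
  induction i generalizing j with
  | zero =>
    obtain ⟨j, rfl⟩ := Nat.exists_eq_add_of_lt h
    rw [Nat.zero_add]
    exact .b3 (mono j)
  | succ i ih =>
    obtain ⟨j, rfl⟩ : ∃ j', j = j' + 1 := ⟨j - 1, by omega⟩
    exact (Derivable.symm (.b2 _ _)).trans ((Derivable.app (.refl B) (ih (by omega))).trans (.b2 _ _))

end Derivable

/-- Insertion of a factor on the right: it moves left past the smaller indices, and grows by one
each time. -/
theorem exists_poly_comp_mono {k : ℕ} {M : List ℕ} (h : (k :: M).IsChain (· ≤ ·)) (i : ℕ) :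
    ∃ k' M', (k' :: M').IsChain (· ≤ ·) ∧ min i k ≤ k' ∧
      Derivable (comp (poly k M) (mono i)) (poly k' M') := by
  induction M generalizing k i with
  | nil =>
    by_cases hi : i ≤ k
    · exact ⟨i, [k], by simpa using hi, by simp, .refl _⟩
    · exact ⟨k, [i + 1], by simp; omega, by simp, .mono_comp_mono (by omega)⟩
  | cons j M ih =>
    by_cases hi : i ≤ k
    · exact ⟨i, k :: j :: M, h.cons_cons hi, by simp, .refl _⟩
    · rw [List.isChain_cons_cons] at h
      obtain ⟨k', M', hc, hk, hd⟩ := ih h.2 (i + 1)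
      refine ⟨k, k' :: M', hc.cons_cons (by omega), by simp, ?_⟩
      exact (Derivable.comp_assoc _ _ _).trans
        ((Derivable.comp (.refl _) (.mono_comp_mono (by omega))).trans
          ((Derivable.comp_assoc _ _ _).symm.trans (hd.comp (.refl _))))

/-- `e` is derivably equal to a product with weakly decreasing indices. -/
def HasPoly (e : BTerm) : Prop :=
  ∃ k M, (k :: M).IsChain (· ≤ ·) ∧ Derivable e (poly k M)

theorem HasPoly.of_derivable {e e' : BTerm} (h : HasPoly e') (hd : Derivable e e') : HasPoly e :=
  let ⟨k, M, hc, h⟩ := h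
  ⟨k, M, hc, hd.trans h⟩

theorem HasPoly.mono (k : ℕ) : HasPoly (mono k) := ⟨k, [], by simp, .refl _⟩

theorem HasPoly.comp_mono {e : BTerm} (h : HasPoly e) (i : ℕ) : HasPoly (comp e (.mono i)) := by
  obtain ⟨k, M, hc, hd⟩ := h
  obtain ⟨k', M', hc', -, hd'⟩ := exists_poly_comp_mono hc i
  exact ⟨k', M', hc', (hd.comp (.refl _)).trans hd'⟩

theorem HasPoly.comp {e e' : BTerm} (h : HasPoly e) (h' : HasPoly e') : HasPoly (comp e e') := by
  obtain ⟨k, M, -, hd⟩ := h'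
  refine .of_derivable ?_ (Derivable.comp (.refl e) hd)
  clear hd
  induction M generalizing k with
  | nil => exact h.comp_mono k
  | cons j M ih => exact ((ih j).comp_mono k).of_derivable (Derivable.comp_assoc _ _ _).symm

theorem HasPoly.app_B {e : BTerm} (h : HasPoly e) : HasPoly (app B e) := by
  obtain ⟨k, M, -, hd⟩ := h
  refine .of_derivable ?_ (Derivable.app (.refl B) hd)
  clear hd
  induction M generalizing k with
  | nil => exact .mono (k + 1)
  | cons j M ih => exact ((ih j).comp_mono (k + 1)).of_derivable (.b2 _ _)

theorem HasPoly.mono_app {e : BTerm} (h : HasPoly e) (k : ℕ) : HasPoly (app (.mono k) e) :=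
  match k with
  | 0 => h.app_B
  | k + 1 => (HasPoly.mono k).comp h

theorem HasPoly.app {e e' : BTerm} (h : HasPoly e) (h' : HasPoly e') : HasPoly (app e e') := by
  obtain ⟨k, M, -, hd⟩ := h
  refine .of_derivable ?_ (hd.app (.refl e'))
  clear hd
  induction M generalizing k e' with
  | nil => exact h'.mono_app k
  | cons j M ih => exact (ih (h'.mono_app k) j).of_derivable (.b1 _ _ _)

theorem exists_poly (e : BTerm) : HasPoly e := by
  induction e with
  | B => exact .mono 0
  | app _ _ h₁ h₂ => exact h₁.app h₂

end BTerm

namespace Lam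

/-! ### Forests -/

/-- Replace the terms at the positions `k` and `k + 1` of a sequence by the application of the
first to the second. -/
def merge : ℕ → (ℕ → Lam) → ℕ → Lam
  | 0, F, 0 => app (F 0) (F 1)
  | 0, F, i + 1 => F (i + 2)
  | _ + 1, F, 0 => F 0
  | k + 1, F, i + 1 => merge k (fun i => F (i + 1)) i

theorem merge_of_lt {k i : ℕ} (h : i < k) (F : ℕ → Lam) : merge k F i = F i := by
  induction k generalizing i F with
  | zero => omega
  | succ k ih =>
    cases i with
    | zero => rfl
    | succ i => exact ih (by omega) _

theorem merge_self (k : ℕ) (F : ℕ → Lam) : merge k F k = app (F k) (F (k + 1)) := by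
  induction k generalizing F with
  | zero => rfl
  | succ k ih => exact ih _

theorem merge_of_gt {k i : ℕ} (h : k < i) (F : ℕ → Lam) : merge k F i = F (i + 1) := by
  induction k generalizing i F with
  | zero =>
    obtain ⟨i, rfl⟩ : ∃ j, i = j + 1 := ⟨i - 1, by omega⟩
    rfl
  | succ k ih =>
    obtain ⟨i, rfl⟩ : ∃ j, i = j + 1 := ⟨i - 1, by omega⟩
    exact ih (by omega) _

theorem merge_injective (k : ℕ) : Function.Injective (merge k) := by
  intro F G h
  have hk : F k = G k ∧ F (k + 1) = G (k + 1) := by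
    have := congrFun h k
    rwa [merge_self, merge_self, app.injEq] at this
  funext i
  rcases lt_trichotomy i k with hi | rfl | hi
  · simpa [merge_of_lt hi] using congrFun h i
  · exact hk.1
  · obtain ⟨i, rfl⟩ : ∃ j, i = j + 1 := ⟨i - 1, by omega⟩
    rcases (show k ≤ i by omega).eq_or_lt with rfl | hi'
    · exact hk.2
    · simpa [merge_of_gt hi'] using congrFun h i

theorem LamFree.merge {F : ℕ → Lam} (hF : ∀ i, LamFree (F i)) (k i : ℕ) :
    LamFree (merge k F i) := by
  rcases lt_trichotomy i k with hi | rfl | hi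
  · rw [merge_of_lt hi]; exact hF _
  · rw [merge_self]; exact .app (hF _) (hF _)
  · rw [merge_of_gt hi]; exact hF _

/-- The forest obtained from a sequence by merging at all positions in `M`, the last one first. -/
def merges (M : List ℕ) (F : ℕ → Lam) : ℕ → Lam := M.foldr merge F

theorem LamFree.merges {F : ℕ → Lam} (hF : ∀ i, LamFree (F i)) (M : List ℕ) (i : ℕ) :
    LamFree (merges M F i) := by
  induction M generalizing i with
  | nil => exact hF i
  | cons k M ih => exact LamFree.merge ih k i

theorem merges_of_lt {M : List ℕ} {i : ℕ} (h : ∀ k ∈ M, i < k) (F : ℕ → Lam) :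
    merges M F i = F i := by
  induction M with
  | nil => rfl
  | cons k M ih =>
    exact (merge_of_lt (h k (by simp)) _).trans (ih fun j hj => h j (by simp [hj]))

/-- The head of a weakly increasing list is the position of the first tree of its forest that is
not a variable. -/
theorem not_lt_of_merges_eq {k k' : ℕ} {M M' : List ℕ} (h' : (k' :: M').IsChain (· ≤ ·))
    (e : merges (k :: M) var = merges (k' :: M') var) : ¬ k < k' := by
  intro hk
  have h₁ : merges (k' :: M') var k = var k := by
    refine merges_of_lt (fun j hj => ?_) _
    rw [List.isChain_iff_pairwise, List.pairwise_cons] at h'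
    rcases List.mem_cons.1 hj with rfl | hj
    · exact hk
    · exact hk.trans_le (h'.1 j hj)
  have h₂ : merges (k :: M) var k = app (merges M var k) (merges M var (k + 1)) := merge_self _ _
  rw [e, h₁] at h₂
  cases h₂

theorem merges_injective {M M' : List ℕ} (h : M.IsChain (· ≤ ·)) (h' : M'.IsChain (· ≤ ·))
    (e : merges M var = merges M' var) : M = M' := by
  have nil_ne : ∀ (k : ℕ) (M : List ℕ), merges [] var ≠ merges (k :: M) var := by
    intro k M e
    have : var k = app (merges M var k) (merges M var (k + 1)) :=
      (congrFun e k).trans (merge_self _ _)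
    cases this
  induction M generalizing M' with
  | nil =>
    cases M' with
    | nil => rfl
    | cons k' M' => exact (nil_ne _ _ e).elim
  | cons k M ih =>
    cases M' with
    | nil => exact (nil_ne _ _ e.symm).elim
    | cons k' M' =>
      obtain rfl : k = k' :=
        le_antisymm (not_lt.1 (not_lt_of_merges_eq h e.symm)) (not_lt.1 (not_lt_of_merges_eq h' e))
      rw [ih h.of_cons h'.of_cons (merge_injective k e)]

/-- The application of `s` to the first `n` terms of the sequence `F`. -/
def apps (s : Lam) (F : ℕ → Lam) : ℕ → Lam
  | 0 => s
  | n + 1 => apps (app s (F 0)) (fun i => F (i + 1)) n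

theorem apps_succ (s : Lam) (F : ℕ → Lam) (n : ℕ) : apps s F (n + 1) = app (apps s F n) (F n) := by
  induction n generalizing s F with
  | zero => rfl
  | succ n ih => exact ih (app s (F 0)) fun i => F (i + 1)

theorem LamFree.apps {s : Lam} (hs : LamFree s) {F : ℕ → Lam} (hF : ∀ i, LamFree (F i)) (n : ℕ) :
    LamFree (apps s F n) := by
  induction n with
  | zero => exact hs
  | succ n ih => rw [apps_succ]; exact .app ih (hF n)

theorem BetaEtaEq.apps {s t : Lam} (h : BetaEtaEq s t) (F : ℕ → Lam) (n : ℕ) :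
    BetaEtaEq (apps s F n) (apps t F n) := by
  induction n with
  | zero => exact h
  | succ n ih => rw [apps_succ, apps_succ]; exact ih.app (.refl _)

theorem apps_var_inj {a m n : ℕ} {F G : ℕ → Lam} (h : apps (var a) F m = apps (var a) G n) :
    m = n ∧ ∀ i < m, F i = G i := by
  induction m generalizing n with
  | zero =>
    cases n with
    | zero => simp
    | succ n => rw [apps_succ] at h; cases h
  | succ m ih =>
    cases n with
    | zero => rw [apps_succ] at h; cases h
    | succ n =>
      rw [apps_succ, apps_succ, app.injEq] at h
      obtain ⟨rfl, hi⟩ := ih h.1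
      refine ⟨rfl, fun i hlt => ?_⟩
      rcases (Nat.lt_succ_iff.1 hlt).eq_or_lt with rfl | hlt
      · exact h.2
      · exact hi i hlt

theorem apps_mono (k : ℕ) (f : Lam) (F : ℕ → Lam) (n : ℕ) :
    BetaEtaEq (apps (app (BTerm.mono k).toLam f) F (n + k + 2)) (apps f (merge k F) (n + k + 1)) := by
  induction k generalizing f F with
  | zero => exact (betaEtaEq_B _ _ _).apps _ _
  | succ k ih => exact ((betaEtaEq_B _ _ _).apps _ _).trans (ih _ _)

/-- Applied to a head `f` and enough arguments, a product merges the arguments into the forest of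
its list of indices. The rightmost factor meets `f` first, so it is the last one to merge. -/
theorem apps_poly (k : ℕ) (M : List ℕ) : ∃ N, ∀ (n : ℕ) (f : Lam) (F : ℕ → Lam),
    BetaEtaEq (apps (app (BTerm.poly k M).toLam f) F (n + N + M.length + 1))
      (apps f (merges (k :: M) F) (n + N)) := by
  induction M generalizing k with
  | nil => exact ⟨k + 1, fun n f F => apps_mono k f F n⟩
  | cons j M ih =>
    obtain ⟨N, hN⟩ := ih j
    refine ⟨N + k + 1, fun n f F => ?_⟩
    have h₁ := hN (n + k + 2) (app (BTerm.mono k).toLam f) F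
    have h₂ := apps_mono k f (merges (j :: M) F) (n + N)
    rw [show n + k + 2 + N + M.length + 1 = n + (N + k + 1) + (j :: M).length + 1 by
      simp only [List.length_cons]; omega, show n + k + 2 + N = n + N + k + 2 by omega] at h₁
    rw [show n + N + k + 1 = n + (N + k + 1) by omega] at h₂
    exact ((betaEtaEq_B _ _ _).apps _ _).trans (h₁.trans h₂)

theorem poly_injective {k k' : ℕ} {M M' : List ℕ} (h : (k :: M).IsChain (· ≤ ·))
    (h' : (k' :: M').IsChain (· ≤ ·))
    (e : BetaEtaEq (BTerm.poly k M).toLam (BTerm.poly k' M').toLam) : k :: M = k' :: M' := by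
  refine merges_injective h h' (funext fun i => ?_)
  obtain ⟨N, hN⟩ := apps_poly k M
  obtain ⟨N', hN'⟩ := apps_poly k' M'
  -- The head variable is irrelevant, as both spines have the same one. The number of arguments
  -- is chosen such that position `i` is still present after all merges.
  have h₁ := hN (i + 1 + N' + M'.length) (var 0) var
  have h₂ := hN' (i + 1 + N + M.length) (var 0) var
  rw [show i + 1 + N + M.length + N' + M'.length + 1 =
    i + 1 + N' + M'.length + N + M.length + 1 by omega] at h₂
  have h₃ := h₁.symm.trans (((e.app (.refl (var 0))).apps var _).trans h₂)
  have hF : ∀ L j, LamFree (merges L var j) := LamFree.merges .var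
  exact (apps_var_inj (LamFree.eq_of_betaEtaEq (.apps (.var 0) (hF _) _)
    (.apps (.var 0) (hF _) _) h₃)).2 i (by omega)

end Lam

theorem mainTheorem1 (e₁ e₂ : BTerm) :
    Lam.BetaEtaEq e₁.toLam e₂.toLam ↔ BTerm.Derivable e₁ e₂ := by
  refine ⟨fun h => ?_, BTerm.Derivable.betaEtaEq⟩
  obtain ⟨k₁, M₁, hc₁, hd₁⟩ := e₁.exists_poly
  obtain ⟨k₂, M₂, hc₂, hd₂⟩ := e₂.exists_poly
  have e := Lam.poly_injective hc₁ hc₂ (hd₁.betaEtaEq.symm.trans (h.trans hd₂.betaEtaEq))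
  obtain ⟨rfl, rfl⟩ := List.cons.inj e
  exact hd₁.trans hd₂.symm
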